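/- Let $G=(V,E)$ be a finite connected simple graph with $n\ge 2$ vertices and maximum, minimum and average degree $d_{\max}$, $d_{\min}$ and $d_{\mathrm{avg}}$. In the choice random walk (CRW) on $G$, a controller is at each step offered two independent uniformly random neighbours (with repetition) of the current vertex and chooses one of them as the next vertex; the choice may be randomised and may depend on the time, on the current offer and on the whole history of positions and offers. For $x\in V$ and $\emptyset\neq S\subseteq V$ let $H_x(S)$ be the minimum, over all strategies of the controller, of the expected first time $t\ge 0$ at which the CRW started at $x$ is in $S$, let $H_x^+(S)$ be the same minimum for the first time $t\ge 1$ (for $x\in S$ this is the optimal return time to $S$), and let $t_{\mathrm{hit}}^{\mathrm{CRW}}(G)=\max_{x,y\in V}H_x(\{y\})$. Let $\pi(S)=\sum_{v\in S}d(v)/(2|E|)$ be the stationary probability of $S$ for the simple random walk, and let $t_{\mathrm{rel}}=1/(1-\lambda_2)$, where $\lambda_2$ is the second largest eigenvalue of the transition matrix of the lazy random walk on $G$ with loop probability $1/2$. Put $\gamma_d=\log_d\frac{d^2}{2d-1}$ for integers $d\ge 2$, and $\gamma_1=0$. Then for every such $G$, every $x\in V$ and every nonempty $S\subseteq V$, $$H_x(S)\le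 12\cdot \pi(S)^{-\gamma_{d_{\max}}}\cdot t_{\mathrm{rel}}\cdot\ln n\qquad\text{and}\qquad H_x^+(S)\le 12\cdot \pi(S)^{-\gamma_{d_{\max}}}\cdot t_{\mathrm{rel}}\cdot\ln n .$$ Consequently, $$t_{\mathrm{hit}}^{\mathrm{CRW}}(G)\le 12\left(\frac{n\cdot d_{\mathrm{avg}}}{d_{\min}}\right)^{\gamma_{d_{\max}}}\cdot t_{\mathrm{rel}}\cdot\ln n .$$ -/

import Mathlib

namespace ChoiceWalk

open MeasureTheory ProbabilityTheory
open scoped ENNReal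

/-! ### The choice random walk -/

/-- What is recorded at one time `t`: the current position `X_t` and the two offered
neighbours `c₁ᵗ`, `c₂ᵗ`. -/
structure State (V : Type*) where
  pos : V
  fst : V
  snd : V

instance {V : Type*} : MeasurableSpace (State V) := ⊤

instance {V : Type*} : DiscreteMeasurableSpace (State V) := ⟨fun _ => trivial⟩

instance {V : Type*} [Finite V] : Finite (State V) :=
  Finite.of_injective (fun z : State V => (z.pos, z.fst, z.snd)) (by
    rintro ⟨_, _, _⟩ ⟨_, _, _⟩ h
    simpa using h)

/-- The history `(X_i, c₁ⁱ, c₂ⁱ)`, `0 ≤ i ≤ t`, which the controller knows at time `t`. -/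
abbrev History (V : Type*) (t : ℕ) : Type _ := (i : Finset.Iic t) → State V

/-- The last entry of a history, that is, the current state. -/
def History.last {V : Type*} {t : ℕ} (h : History V t) : State V :=
  h ⟨t, Finset.mem_Iic.2 le_rfl⟩

/-- A (randomised, time- and history-dependent) strategy: given the time and the whole history,
including the current offer, it returns the distribution of the decision;
`true` means that the first offered neighbour is chosen, `false` that the second one is. -/
abbrev Strategy (V : Type*) : Type _ := (t : ℕ) → History V t → PMF Bool

section Walk

variable {V : Type*} [Fintype V] (G : SimpleGraph V) [DecidableRel G.Adj]

/-- The walk being at `v`, two neighbours of `v` are drawn independently and uniformly (with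
repetition). The value at an isolated vertex is a convention that is never used in a connected
graph with at least two vertices. -/
noncomputable def offer (v : V) : PMF (State V) :=
  if h : (G.neighborFinset v).Nonempty then
    (PMF.uniformOfFinset (G.neighborFinset v) h).bind fun a =>
      (PMF.uniformOfFinset (G.neighborFinset v) h).bind fun b => PMF.pure ⟨v, a, b⟩
  else PMF.pure ⟨v, v, v⟩

/-- One step: the controller decides, the walk moves to the chosen neighbour, and a fresh pair of
neighbours of the new position is offered. -/
noncomputable def step (σ : Strategy V) (t : ℕ) (h : History V t) : PMF (State V) :=
  (σ t h).bind fun d => offer G (if d then h.last.fst else h.last.snd)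

/-- The law of the state at time `t + 1` given the history up to time `t`. -/
noncomputable def stepKernel (σ : Strategy V) (t : ℕ) : Kernel (History V t) (State V) :=
  Kernel.ofFunOfCountable fun h => (step G σ t h).toMeasure

instance (σ : Strategy V) (t : ℕ) : IsMarkovKernel (stepKernel G σ t) :=
  ⟨fun h => PMF.toMeasure.isProbabilityMeasure (step G σ t h)⟩

/-- The law of the whole choice random walk started at `x` under the strategy `σ`. -/
noncomputable def law (σ : Strategy V) (x : V) : Measure (ℕ → State V) :=
  Kernel.trajMeasure (X := fun _ => State V) (offer G x).toMeasure (stepKernel G σ)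

/-- The first time `t ≥ m` with `X_t ∈ S`, and `∞` if there is none. Here `m = 0` gives the hitting
time `τ_S` and `m = 1` gives the return time `τ_S⁺`. -/
noncomputable def firstVisit (m : ℕ) (S : Finset V) (ω : ℕ → State V) : ℝ≥0∞ :=
  ⨅ (t : ℕ) (_ : m ≤ t ∧ (ω t).pos ∈ S), (t : ℝ≥0∞)

/-- `H_x(S)`: the least expected time, over all strategies, to reach `S` from `x`. -/
noncomputable def hit (x : V) (S : Finset V) : ℝ≥0∞ :=
  ⨅ σ : Strategy V, ∫⁻ ω, firstVisit 0 S ω ∂(law G σ x)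

/-- The least expected time, over all strategies, of the first visit to `S` at a time `t ≥ 1`, for
the walk started at `x`; for `x ∈ S` it is the optimal return time to `S`. -/
noncomputable def ret (x : V) (S : Finset V) : ℝ≥0∞ :=
  ⨅ σ : Strategy V, ∫⁻ ω, firstVisit 1 S ω ∂(law G σ x)

/-- The hitting time of the choice random walk on `G`: the maximum of `H_x(y)` over all pairs of
vertices. -/
noncomputable def maxHit : ℝ≥0∞ := ⨆ (x : V) (y : V), hit G x {y}

end Walk

/-! ### Graph parameters -/

section Parameters

variable {V : Type*} [Fintype V] (G : SimpleGraph V) [DecidableRel G.Adj]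

/-- The transition matrix of the simple random walk. -/
noncomputable def walkMatrix : Matrix V V ℝ :=
  Matrix.of fun v w => if G.Adj v w then 1 / (G.degree v : ℝ) else 0

/-- The transition matrix of the lazy random walk with loop probability `1/2`. -/
noncomputable def lazyMatrix [DecidableEq V] : Matrix V V ℝ :=
  (1 / 2 : ℝ) • (1 + walkMatrix G)

/-- The second largest eigenvalue of the lazy walk: the eigenvalues are the roots of the
characteristic polynomial, listed with multiplicity in decreasing order, and the entry of index `1`
is taken. (All eigenvalues are real, so the list has as many entries as `G` has vertices.) -/
noncomputable def lambdaTwo [DecidableEq V] : ℝ :=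
  ((lazyMatrix G).charpoly.roots.sort (· ≥ ·)).getD 1 0

/-- The relaxation time. -/
noncomputable def relaxTime [DecidableEq V] : ℝ := 1 / (1 - lambdaTwo G)

/-- The stationary probability `π(S)` of a set of vertices, `π` being the stationary distribution
`π(v) = d(v) / ∑ u, d(u)` of the simple random walk. -/
noncomputable def statProb (S : Finset V) : ℝ :=
  ∑ v ∈ S, (G.degree v : ℝ) / ∑ u, (G.degree u : ℝ)

/-- The average degree. -/
noncomputable def avgDegree : ℝ := (∑ v, (G.degree v : ℝ)) / Fintype.card V

end Parameters

/-- `γ_d = log_d (d² / (2 d - 1))`; for `d = 1` the value is `0`. -/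
noncomputable def gammaExp (d : ℕ) : ℝ := Real.logb d ((d : ℝ) ^ 2 / (2 * (d : ℝ) - 1))

end ChoiceWalk

/-! Let `hitProb G S T x` be the probability that the simple random walk visits `S` within `T`
steps. If `T` is about `t_rel * (2 log n + log 2)`, the spectral gap makes the lazy walk give every
vertex at least half its stationary mass at time `T`; since laziness only delays visits, `hitProb G
S T x ≥ π(S)/2` for every start `x` (`half_statProb_le_hitProb`).

The controller always moves to the offered vertex with the larger `hitProb` for the time remaining
in the current block of length `T`. For at most `D = d_max` neighbours, the average over two samples
of `max (p_i^γ) (p_j^γ)` is at least the `γ`-th power of the average of `p` (`boost_average_le`). By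
iteration, a success probability `p` of the simple walk becomes at least `p^γ` for the choice walk.
Each block thus succeeds with probability at least `(π(S)/2)^γ`, and restarting after failures gives
expected time at most `T * (π(S)/2)^(-γ)`. This restart argument is carried by a potential function
(`exists_lyapunov`) and a drift criterion (`lintegral_firstVisit_le`), which avoid any conditioning
on block events. -/

namespace ChoiceWalk

/-! ### The exponent `γ_d` -/

lemma gammaExp_mul_log {D : ℕ} (hD : 2 ≤ D) :
    gammaExp D * Real.log D = 2 * Real.log D - Real.log (2 * (D : ℝ) - 1) := by
  have h : (2 : ℝ) ≤ D := by exact_mod_cast hD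
  have hl : Real.log D ≠ 0 := (Real.log_pos (by linarith)).ne'
  rw [gammaExp, Real.logb, div_mul_cancel₀ _ hl, Real.log_div (by positivity) (by linarith),
    Real.log_pow]
  norm_num

lemma gammaExp_pos {D : ℕ} (hD : 2 ≤ D) : 0 < gammaExp D := by
  have h : (2 : ℝ) ≤ D := by exact_mod_cast hD
  have hl : 0 < Real.log D := Real.log_pos (by linarith)
  refine pos_of_mul_pos_left ?_ hl.le
  rw [gammaExp_mul_log hD, sub_pos, show 2 * Real.log D = Real.log ((D : ℝ) ^ 2) by
    rw [Real.log_pow]; norm_num]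
  exact Real.log_lt_log (by linarith) (by nlinarith)

lemma gammaExp_le_one (D : ℕ) : gammaExp D ≤ 1 := by
  rcases Nat.lt_or_ge D 2 with h | hD
  · have : (D : ℝ) = 0 ∨ (D : ℝ) = 1 := by
      interval_cases D <;> simp
    rcases this with h | h <;> simp [gammaExp, h]
  have h : (2 : ℝ) ≤ D := by exact_mod_cast hD
  have hl : 0 < Real.log D := Real.log_pos (by linarith)
  refine le_of_mul_le_mul_right ?_ hl
  rw [gammaExp_mul_log hD]
  have := Real.log_le_log (by linarith : (0 : ℝ) < D) (by linarith : (D : ℝ) ≤ 2 * D - 1)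
  linarith

lemma gammaExp_one : gammaExp 1 = 0 := by simp [gammaExp]

lemma gammaExp_nonneg {D : ℕ} (hD : 1 ≤ D) : 0 ≤ gammaExp D := by
  rcases hD.eq_or_lt with rfl | h
  · exact gammaExp_one.ge
  · exact (gammaExp_pos h).le

/-- The inequality of the boosting lemma for indicator functions of density `u`. -/
lemma rpow_gammaExp_le {D : ℕ} (hD : 2 ≤ D) {u : ℝ} (hu : 1 / (D : ℝ) ≤ u) (hu1 : u ≤ 1) :
    u ^ gammaExp D ≤ u * (2 - u) := by
  have h : (2 : ℝ) ≤ D := by exact_mod_cast hD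
  have hDpos : (0 : ℝ) < D := by linarith
  have hinv : 0 < 1 / (D : ℝ) := by positivity
  have hinv1 : 1 / (D : ℝ) < 1 := by rw [div_lt_one hDpos]; linarith
  have hupos : 0 < u := hinv.trans_le hu
  -- Write `u` as the convex combination `a * (1/D) + (1 - a) * 1`. The function `(1 - γ) log u +
  -- log (2 - u)` is concave because `γ ≤ 1`; it vanishes at `u = 1`, and at `u = 1/D` by the choice
  -- of `γ`, so it is nonnegative in between.
  set a : ℝ := (1 - u) / (1 - 1 / (D : ℝ)) with ha
  have hden : 0 < 1 - 1 / (D : ℝ) := by linarith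
  have ha0 : 0 ≤ a := div_nonneg (by linarith) hden.le
  have ha1 : a ≤ 1 := by rw [ha, div_le_one hden]; linarith
  have hau : a * (1 - 1 / (D : ℝ)) = 1 - u := by rw [ha, div_mul_cancel₀ _ hden.ne']
  have c := strictConcaveOn_log_Ioi.concaveOn
  have h1 := c.2 (Set.mem_Ioi.2 hinv) (Set.mem_Ioi.2 one_pos) ha0 (sub_nonneg.2 ha1)
    (add_sub_cancel a 1)
  have h2 := c.2 (Set.mem_Ioi.2 (by linarith : 0 < 2 - 1 / (D : ℝ))) (Set.mem_Ioi.2 one_pos) ha0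
    (sub_nonneg.2 ha1) (add_sub_cancel a 1)
  simp only [smul_eq_mul, Real.log_one, mul_zero, add_zero] at h1 h2
  rw [show a * (1 / (D : ℝ)) + (1 - a) * 1 = u by linarith] at h1
  rw [show a * (2 - 1 / (D : ℝ)) + (1 - a) * 1 = 2 - u by linarith] at h2
  have hg := gammaExp_mul_log hD
  have hlinv : Real.log (1 / (D : ℝ)) = - Real.log D := by simp
  have hl2 : Real.log (2 - 1 / (D : ℝ)) = Real.log (2 * (D : ℝ) - 1) - Real.log D := by
    rw [← Real.log_div (by linarith) hDpos.ne']
    congr 1; field_simp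
  rw [hlinv] at h1
  rw [hl2] at h2
  have h2u : 0 < 2 - u := by linarith
  rw [← Real.log_le_log_iff (by positivity) (by positivity), Real.log_rpow hupos,
    Real.log_mul hupos.ne' h2u.ne']
  have hγ := gammaExp_le_one D
  have h3 := mul_le_mul_of_nonneg_left h1 (sub_nonneg.2 hγ)
  have h4 : (1 - gammaExp D) * (a * -Real.log D) =
      -(a * (Real.log (2 * (D : ℝ) - 1) - Real.log D)) := by
    have : (1 - gammaExp D) * (a * -Real.log D) =
      a * (gammaExp D * Real.log D) - a * Real.log D := by ring
    rw [this, hg]; ring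
  linarith

/-! ### The boosting inequality -/

section Boost

variable {ι : Type*}

/-- Inclusion–exclusion: the maximum of two indicators is their sum minus their product. -/
lemma sum_sum_max_indicator (s : Finset ι) (P : ι → Prop) [DecidablePred P] {m : ℝ} (hm : 0 ≤ m) :
    ∑ i ∈ s, ∑ j ∈ s, max (if P i then m else 0) (if P j then m else 0) =
      m * ((s.filter P).card * (2 * s.card - (s.filter P).card)) := by
  set e : ι → ℝ := fun i => if P i then 1 else 0 with he
  have h : ∀ i j, max (if P i then m else 0) (if P j then m else 0) =
      m * (e i + e j - e i * e j) := by
    intro i j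
    by_cases hi : P i <;> by_cases hj : P j <;> simp [he, hi, hj, hm]
  have hsum : ∑ i ∈ s, e i = (s.filter P).card := Finset.sum_boole _ _
  simp only [h, ← Finset.mul_sum, Finset.sum_sub_distrib, Finset.sum_add_distrib, hsum,
    Finset.sum_const, nsmul_eq_mul, ← Finset.sum_mul]
  ring

/-- A lower bound for the expected maximum of two independent uniform samples by a power mean; it
suffices to have it for indicator functions. -/
lemma rpow_sum_le_sum_sum_max {p c : ℝ} (hp : 1 ≤ p) (hc : 0 ≤ c) (s : Finset ι)
    (hs : ∀ k : ℕ, 1 ≤ k → k ≤ s.card → (k : ℝ) ^ (1 / p) * c ≤ k * (2 * s.card - k))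
    (y : ι → ℝ) (hy : ∀ i, 0 ≤ y i) :
    (∑ i ∈ s, y i ^ p) ^ (1 / p) * c ≤ ∑ i ∈ s, ∑ j ∈ s, max (y i) (y j) := by
  have hp0 : p ≠ 0 := by linarith
  -- Layer-cake induction on the size of the support: peel off the minimal positive value `m` as a
  -- multiple of an indicator. The left side is an `ℓ^p` norm, hence subadditive, while the right
  -- side is additive along this decomposition.
  induction hn : (s.filter (0 < y ·)).card using Nat.strong_induction_on generalizing y with
  | _ n ih =>
  subst hn
  set T := s.filter (0 < y ·) with hT
  rcases T.eq_empty_or_nonempty with hTe | hTne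
  · have hz : ∀ i ∈ s, y i = 0 := by
      intro i hi
      by_contra hne
      have : i ∈ T := by rw [hT, Finset.mem_filter]; exact ⟨hi, lt_of_le_of_ne (hy i) (Ne.symm hne)⟩
      simp [hTe] at this
    have : ∑ i ∈ s, y i ^ p = 0 := Finset.sum_eq_zero fun i hi => by
      rw [hz i hi, Real.zero_rpow hp0]
    rw [this, Real.zero_rpow (by positivity), zero_mul]
    exact Finset.sum_nonneg fun i _ => Finset.sum_nonneg fun j _ => le_max_of_le_left (hy i)
  obtain ⟨i₀, hi₀, hmin⟩ := T.exists_min_image y hTne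
  set m := y i₀ with hm
  have hmpos : 0 < m := (Finset.mem_filter.1 hi₀).2
  set z : ι → ℝ := fun i => if 0 < y i then m else 0 with hz
  -- The bound `m ≤ y i` is known only on `s`; the truncation keeps `y'` nonnegative at all indices.
  set y' : ι → ℝ := fun i => if 0 < y i then max (y i - m) 0 else 0 with hy'
  have hz0 : ∀ i, 0 ≤ z i := fun i => by simp only [hz]; split_ifs <;> linarith
  have hy'0 : ∀ i, 0 ≤ y' i := fun i => by
    simp only [hy']; split_ifs
    · exact le_max_right _ _
    · exact le_rfl
  have hle : ∀ i ∈ s, 0 < y i → m ≤ y i := fun i hi h => hmin i (Finset.mem_filter.2 ⟨hi, h⟩)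
  have hsum : ∀ i ∈ s, y i = z i + y' i := by
    intro i hi
    by_cases h : 0 < y i
    · simp [hz, hy', h, hle i hi h]
    · have : y i = 0 := le_antisymm (not_lt.1 h) (hy i)
      simp [hz, hy', this]
  -- Additivity holds because `z` and `y'` are ordered in the same way: both are nondecreasing
  -- functions of `y` on `s`.
  have hmax : ∀ i ∈ s, ∀ j ∈ s, max (y i) (y j) = max (z i) (z j) + max (y' i) (y' j) := by
    intro i hi j hj
    by_cases h : 0 < y i <;> by_cases h' : 0 < y j
    · have a := hle i hi h
      have b := hle j hj h'
      simp only [hz, hy', h, h', if_true, max_self, max_eq_left (sub_nonneg.2 a),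
        max_eq_left (sub_nonneg.2 b), max_sub_sub_right]
      ring
    · have a := hle i hi h
      have h0 : y j = 0 := le_antisymm (not_lt.1 h') (hy j)
      simp [hz, hy', h, h0, hy i, a, hmpos.le]
    · have b := hle j hj h'
      have h0 : y i = 0 := le_antisymm (not_lt.1 h) (hy i)
      simp [hz, hy', h', h0, hy j, b, hmpos.le]
    · have h0 : y i = 0 := le_antisymm (not_lt.1 h) (hy i)
      have h0' : y j = 0 := le_antisymm (not_lt.1 h') (hy j)
      simp [hz, hy', h0, h0']
  have hcard : (s.filter (0 < y' ·)).card < T.card := by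
    refine Finset.card_lt_card ⟨?_, ?_⟩
    · intro i hi
      rw [Finset.mem_filter] at hi
      rw [hT, Finset.mem_filter]
      refine ⟨hi.1, ?_⟩
      by_contra h
      simp [hy', h] at hi
    · intro h
      have := h hi₀
      simp [hy', ← hm] at this
  have hrec := ih _ hcard y' hy'0 rfl
  have hind : (∑ i ∈ s, z i ^ p) ^ (1 / p) * c ≤ ∑ i ∈ s, ∑ j ∈ s, max (z i) (z j) := by
    have h1 : ∑ i ∈ s, z i ^ p = T.card * m ^ p := by
      have : ∀ i, z i ^ p = if 0 < y i then m ^ p else 0 := fun i => by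
        simp only [hz]; split_ifs
        · rfl
        · exact Real.zero_rpow hp0
      simp only [this, ← Finset.sum_filter, Finset.sum_const, nsmul_eq_mul, hT]
    rw [h1, Real.mul_rpow (by positivity) (by positivity), ← Real.rpow_mul hmpos.le,
      mul_one_div_cancel hp0, Real.rpow_one, sum_sum_max_indicator s _ hmpos.le]
    have := hs T.card hTne.card_pos (Finset.card_filter_le _ _)
    calc _ = m * ((T.card : ℝ) ^ (1 / p) * c) := by ring
      _ ≤ _ := mul_le_mul_of_nonneg_left this hmpos.le
  calc (∑ i ∈ s, y i ^ p) ^ (1 / p) * c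
      = (∑ i ∈ s, (z i + y' i) ^ p) ^ (1 / p) * c := by
        rw [Finset.sum_congr rfl fun i hi => by rw [hsum i hi]]
    _ ≤ ((∑ i ∈ s, z i ^ p) ^ (1 / p) + (∑ i ∈ s, y' i ^ p) ^ (1 / p)) * c :=
        mul_le_mul_of_nonneg_right
          (Real.Lp_add_le_of_nonneg _ hp (fun i _ => hz0 i) fun i _ => hy'0 i) hc
    _ ≤ ∑ i ∈ s, ∑ j ∈ s, max (z i) (z j) + ∑ i ∈ s, ∑ j ∈ s, max (y' i) (y' j) := by
        rw [add_mul]; exact add_le_add hind hrec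
    _ = ∑ i ∈ s, ∑ j ∈ s, max (y i) (y j) := by
        simp only [← Finset.sum_add_distrib]
        exact Finset.sum_congr rfl fun i hi => Finset.sum_congr rfl fun j hj =>
          (hmax i hi j hj).symm

/-- The function by which a success probability of the simple random walk is boosted when
the choice random walk is used instead. -/
noncomputable def boost (D : ℕ) (p : ℝ) : ℝ := if p = 0 then 0 else p ^ gammaExp D

lemma boost_of_pos {D : ℕ} {p : ℝ} (hp : 0 < p) : boost D p = p ^ gammaExp D := if_neg hp.ne'

lemma boost_zero (D : ℕ) : boost D 0 = 0 := if_pos rfl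

lemma boost_one (D : ℕ) : boost D 1 = 1 := by simp [boost]

lemma boost_nonneg (D : ℕ) {p : ℝ} (hp : 0 ≤ p) : 0 ≤ boost D p := by
  unfold boost; split_ifs
  · exact le_rfl
  · positivity

lemma boost_mono {D : ℕ} (hD : 1 ≤ D) {p q : ℝ} (hp : 0 ≤ p) (hpq : p ≤ q) :
    boost D p ≤ boost D q := by
  rcases hp.eq_or_lt with rfl | h
  · rw [boost_zero]; exact boost_nonneg D hpq
  · rw [boost_of_pos h, boost_of_pos (h.trans_le hpq)]
    exact Real.rpow_le_rpow hp hpq (gammaExp_nonneg hD)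

lemma boost_le_one {D : ℕ} (hD : 1 ≤ D) {p : ℝ} (hp : 0 ≤ p) (hp1 : p ≤ 1) : boost D p ≤ 1 :=
  (boost_mono hD hp hp1).trans_eq (boost_one D)

/-- **Boosting lemma**: one step of the choice random walk. -/
lemma boost_average_le {D : ℕ} (s : Finset ι) (hs : s.Nonempty) (hD : s.card ≤ D)
    (p : ι → ℝ) (hp : ∀ i, 0 ≤ p i) :
    boost D ((∑ i ∈ s, p i) / s.card) ≤
      (∑ i ∈ s, ∑ j ∈ s, max (boost D (p i)) (boost D (p j))) / (s.card : ℝ) ^ 2 := by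
  have hcard : 1 ≤ s.card := hs.card_pos
  have hd : (0 : ℝ) < s.card := by exact_mod_cast hcard
  -- For `D = 1` the exponent is `0` and `boost` is the indicator of `p ≠ 0`, but then `s` is a
  -- singleton.
  rcases Nat.lt_or_ge D 2 with hD2 | hD2
  · have h1 : s.card = 1 := by omega
    obtain ⟨i, rfl⟩ := Finset.card_eq_one.1 h1
    simp
  have hγ := gammaExp_pos hD2
  have hboost : ∀ q, boost D q = q ^ gammaExp D := by
    intro q
    unfold boost; split_ifs with h
    · rw [h, Real.zero_rpow hγ.ne']
    · rfl
  simp only [hboost]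
  set γ := gammaExp D
  -- With `y = p^γ` the `ℓ^(1/γ)` norm is `(∑ p)^γ`; the constant `c` turns the sums over `s` and
  -- over pairs into averages. The condition on `k` is the indicator case at density `u = k /
  -- s.card`, which is at least `1/D`.
  have key := rpow_sum_le_sum_sum_max (p := 1 / γ) (c := (s.card : ℝ) ^ (2 - γ))
    (by rw [le_div_iff₀ hγ]; linarith [gammaExp_le_one D]) (by positivity) s (by
      intro k hk1 hks
      have hk : (0 : ℝ) < k := by exact_mod_cast hk1
      have hkd : (k : ℝ) ≤ s.card := by exact_mod_cast hks
      have hdD : (s.card : ℝ) ≤ D := by exact_mod_cast hD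
      have := rpow_gammaExp_le hD2 (u := k / s.card) (by
        have h1k : (1 : ℝ) ≤ k := by exact_mod_cast hk1
        gcongr) (by rw [div_le_one hd]; exact hkd)
      rw [Real.div_rpow hk.le hd.le] at this
      rw [one_div_one_div, Real.rpow_sub hd]
      have h2 : (s.card : ℝ) ^ (2 : ℝ) = (s.card : ℝ) ^ 2 := by norm_cast
      rw [h2]
      calc (k : ℝ) ^ γ * ((s.card : ℝ) ^ 2 / (s.card : ℝ) ^ γ)
          = (s.card : ℝ) ^ 2 * ((k : ℝ) ^ γ / (s.card : ℝ) ^ γ) := by ring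
        _ ≤ (s.card : ℝ) ^ 2 * (k / s.card * (2 - k / s.card)) :=
            mul_le_mul_of_nonneg_left this (by positivity)
        _ = k * (2 * s.card - k) := by field_simp)
    (fun i => p i ^ γ) (fun i => Real.rpow_nonneg (hp i) _)
  rw [one_div_one_div, Finset.sum_congr rfl fun i _ => by
    rw [← Real.rpow_mul (hp i), mul_one_div_cancel hγ.ne', Real.rpow_one]] at key
  rw [le_div_iff₀ (by positivity)]
  refine le_trans (le_of_eq ?_) key
  rw [Real.div_rpow (Finset.sum_nonneg fun i _ => hp i) hd.le, Real.rpow_sub hd]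
  have h2 : (s.card : ℝ) ^ (2 : ℝ) = (s.card : ℝ) ^ 2 := by norm_cast
  rw [h2]; ring

end Boost

end ChoiceWalk

namespace ChoiceWalk
open MeasureTheory ProbabilityTheory
open scoped ENNReal

/-! ### The law of the walk and the drift criterion -/

lemma lintegral_toMeasure {α : Type*} [MeasurableSpace α] [DiscreteMeasurableSpace α] [Countable α]
    (p : PMF α) (F : α → ℝ≥0∞) : ∫⁻ a, F a ∂p.toMeasure = ∑' a, p a * F a := by
  rw [lintegral_countable']
  exact tsum_congr fun a => by rw [p.toMeasure_apply_singleton _ (.singleton a), mul_comm]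

lemma tsum_bind_mul {α β : Type*} (p : PMF α) (q : α → PMF β) (F : β → ℝ≥0∞) :
    ∑' b, p.bind q b * F b = ∑' a, p a * ∑' b, q a b * F b := by
  simp only [PMF.bind_apply, ← ENNReal.tsum_mul_right, ← ENNReal.tsum_mul_left]
  rw [ENNReal.tsum_comm]
  simp only [mul_assoc]

lemma tsum_uniformOfFinset_mul {α : Type*} (s : Finset α) (hs : s.Nonempty) (F : α → ℝ≥0∞) :
    ∑' a, PMF.uniformOfFinset s hs a * F a = (s.card : ℝ≥0∞)⁻¹ * ∑ a ∈ s, F a := by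
  rw [tsum_eq_sum (s := s) fun a ha => by simp [PMF.uniformOfFinset_apply_of_notMem hs ha],
    Finset.mul_sum]
  exact Finset.sum_congr rfl fun a ha => by rw [PMF.uniformOfFinset_apply_of_mem hs ha]

variable {V : Type*} [Fintype V] (G : SimpleGraph V) [DecidableRel G.Adj]

lemma lintegral_offer {v : V} (hv : (G.neighborFinset v).Nonempty) (F : State V → ℝ≥0∞) :
    ∫⁻ z, F z ∂(offer G v).toMeasure =
      (G.degree v : ℝ≥0∞)⁻¹ * ∑ a ∈ G.neighborFinset v,
        ((G.degree v : ℝ≥0∞)⁻¹ * ∑ b ∈ G.neighborFinset v, F ⟨v, a, b⟩) := by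
  rw [lintegral_toMeasure, offer, dif_pos hv]
  simp only [tsum_bind_mul, tsum_uniformOfFinset_mul, G.card_neighborFinset_eq_degree]
  refine congrArg _ (Finset.sum_congr rfl fun a _ => congrArg _ (Finset.sum_congr rfl fun b _ => ?_))
  rw [tsum_eq_single (⟨v, a, b⟩ : State V) fun z hz => by simp [PMF.pure_apply, hz]]
  simp

variable {G}

lemma lintegral_law_zero (σ : Strategy V) (x : V) (F : State V → ℝ≥0∞) :
    ∫⁻ ω, F (ω 0) ∂law G σ x = ∫⁻ z, F z ∂(offer G x).toMeasure := by
  have hF : Measurable F := measurable_of_countable F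
  have h0 : ∀ h : History V 0, ∫⁻ ω : ℕ → State V, F (ω 0)
      ∂(Kernel.traj (stepKernel G σ) 0 h) = F h.last := by
    intro h
    have hm := Kernel.traj_map_frestrictLe_apply (X := fun _ => State V)
      (κ := stepKernel G σ) 0 0 h
    rw [Kernel.partialTraj_self] at hm
    have : ∫⁻ ω, F (History.last (Preorder.frestrictLe (π := fun _ => State V) 0 ω))
        ∂(Kernel.traj (stepKernel G σ) 0 h) = F h.last := by
      rw [← lintegral_map (f := fun g : History V 0 => F g.last) (measurable_of_countable _)
        (by fun_prop), hm]
      simp [Kernel.id_apply]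
    exact this
  rw [law, Kernel.trajMeasure, Measure.lintegral_bind (Kernel.aemeasurable _)
    (by
      have : Measurable fun ω : ℕ → State V => F (ω 0) := hF.comp (measurable_pi_apply 0)
      exact this.aemeasurable)]
  simp only [h0]
  rw [lintegral_map (measurable_of_countable _) (by fun_prop)]
  rfl

/-- The one-step conditioning rule, read off from the disintegration of the trajectory measure at
time `t`. -/
lemma lintegral_law_succ (σ : Strategy V) (x : V) (t : ℕ) (F : History V t → State V → ℝ≥0∞) :
    ∫⁻ ω, F (Preorder.frestrictLe (π := fun _ => State V) t ω) (ω (t + 1)) ∂law G σ x =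
      ∫⁻ ω, ∫⁻ z, F (Preorder.frestrictLe (π := fun _ => State V) t ω) z
        ∂(step G σ t (Preorder.frestrictLe (π := fun _ => State V) t ω)).toMeasure ∂law G σ x := by
  have key := Kernel.map_frestrictLe_trajMeasure_compProd_eq_map_trajMeasure
    (X := fun _ => State V) (μ₀ := (offer G x).toMeasure) (κ := stepKernel G σ) (a := t)
  have hF : Measurable (Function.uncurry F) := measurable_of_countable _
  have h1 := congrArg (fun μ => ∫⁻ y, Function.uncurry F y ∂μ) key
  rw [lintegral_map hF (by fun_prop), Measure.lintegral_compProd hF,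
    lintegral_map (measurable_of_countable _) (by fun_prop)] at h1
  exact h1.symm

open Classical in
/-- The indicator of the event that there is no visit to `S` at a time in `[m, t]`. -/
noncomputable def avoids (m : ℕ) (S : Finset V) (t : ℕ) (h : History V t) : ℝ≥0∞ :=
  if ∀ i : Finset.Iic t, m ≤ (i : ℕ) → (h i).pos ∉ S then 1 else 0

omit [Fintype V] in
lemma avoids_frestrictLe (m : ℕ) (S : Finset V) (t : ℕ) (ω : ℕ → State V) [Decidable
    (∀ i ≤ t, m ≤ i → (ω i).pos ∉ S)] :
    avoids m S t (Preorder.frestrictLe (π := fun _ => State V) t ω) =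
      if ∀ i ≤ t, m ≤ i → (ω i).pos ∉ S then 1 else 0 := by
  unfold avoids
  simp only [Preorder.frestrictLe_apply, Subtype.forall, Finset.mem_Iic]

omit [Fintype V] in
lemma avoids_zero [DecidableEq V] (m : ℕ) (S : Finset V) (ω : ℕ → State V) :
    avoids m S 0 (Preorder.frestrictLe (π := fun _ => State V) 0 ω) =
      if m ≤ 0 → (ω 0).pos ∉ S then 1 else 0 := by
  classical
  rw [avoids_frestrictLe]
  simp

omit [Fintype V] in
lemma avoids_succ [DecidableEq V] (m : ℕ) (S : Finset V) (t : ℕ) (ω : ℕ → State V) :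
    avoids m S (t + 1) (Preorder.frestrictLe (π := fun _ => State V) (t + 1) ω) =
      avoids m S t (Preorder.frestrictLe (π := fun _ => State V) t ω) *
        if m ≤ t + 1 → (ω (t + 1)).pos ∉ S then 1 else 0 := by
  classical
  rw [avoids_frestrictLe, avoids_frestrictLe, ite_zero_mul_ite_zero, one_mul]
  congr 1
  refine propext ⟨fun h => ⟨fun i hi => h i (by omega), h _ le_rfl⟩, fun h i hi => ?_⟩
  rcases Nat.le_succ_iff.1 hi with hi | rfl
  · exact h.1 i hi
  · exact h.2

omit [Fintype V] in
-- The right side counts the times up to which no admissible visit has occurred; times `t < m` count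
-- vacuously.
lemma firstVisit_le_tsum (m : ℕ) (S : Finset V) (ω : ℕ → State V) :
    firstVisit m S ω ≤
      ∑' t, avoids m S t (Preorder.frestrictLe (π := fun _ => State V) t ω) := by
  classical
  simp only [avoids_frestrictLe]
  by_cases h : ∃ t, m ≤ t ∧ (ω t).pos ∈ S
  · have hspec := Nat.find_spec h
    have hmin : ∀ i < Nat.find h, m ≤ i → (ω i).pos ∉ S := fun i hi hm hS =>
      Nat.find_min h hi ⟨hm, hS⟩
    calc firstVisit m S ω ≤ (Nat.find h : ℝ≥0∞) :=
          iInf₂_le (f := fun (t : ℕ) (_ : m ≤ t ∧ (ω t).pos ∈ S) => (t : ℝ≥0∞)) _ hspec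
      _ = ∑ t ∈ Finset.range (Nat.find h), 1 := by simp
      _ = ∑ t ∈ Finset.range (Nat.find h),
            (if ∀ i ≤ t, m ≤ i → (ω i).pos ∉ S then (1 : ℝ≥0∞) else 0) :=
          Finset.sum_congr rfl fun t ht => by
            rw [if_pos fun i hi => hmin i (hi.trans_lt (Finset.mem_range.1 ht))]
      _ ≤ _ := ENNReal.sum_le_tsum _
  · push Not at h
    have h1 : ∀ t, (if ∀ i ≤ t, m ≤ i → (ω i).pos ∉ S then (1 : ℝ≥0∞) else 0) = 1 := fun t =>
      if_pos fun i _ hi => h i hi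
    simp only [h1, ENNReal.tsum_const_eq_top_of_ne_zero one_ne_zero]
    exact le_top

/-- The position chosen at a state by a deterministic decision. -/
def State.choose (z : State V) (d : Bool) : V := if d then z.fst else z.snd

/-- The strategy which decides on the basis of the time and the current state only. -/
noncomputable def markovStrategy (δ : ℕ → State V → Bool) : Strategy V :=
  fun t h => PMF.pure (δ t h.last)

lemma step_markovStrategy (δ : ℕ → State V → Bool) (t : ℕ) (h : History V t) :
    step G (markovStrategy δ) t h = offer G (h.last.choose (δ t h.last)) := by
  simp [step, markovStrategy, State.choose]

/-- Verification lemma: a function of time and position which decreases in mean by at least one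
in each step until the visit bounds the expected time of the visit. -/
lemma lintegral_firstVisit_le [DecidableEq V] (hG : ∀ v, (G.neighborFinset v).Nonempty)
    (δ : ℕ → State V → Bool)
    (m : ℕ) (S : Finset V) (Φ : ℕ → V → ℝ≥0∞)
    (hΦ : ∀ t v, (m ≤ t → v ∉ S) →
      ∫⁻ z, (1 + Φ (t + 1) (z.choose (δ t z))) ∂(offer G v).toMeasure ≤ Φ t v) (x : V) :
    ∫⁻ ω, firstVisit m S ω ∂law G (markovStrategy δ) x ≤ Φ 0 x := by
  set μ := law G (markovStrategy δ) x with hμ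
  let r (t : ℕ) (ω : ℕ → State V) : History V t := Preorder.frestrictLe (π := fun _ => State V) t ω
  have hr : ∀ t, Measurable fun ω => avoids m S t (r t ω) := fun t =>
    (measurable_of_countable (avoids m S t)).comp (by fun_prop : Measurable (r t))
  let U (t : ℕ) (z : State V) : ℝ≥0∞ := 1 + Φ (t + 1) (z.choose (δ t z))
  have hpos : ∀ t v, ∫⁻ z, (if m ≤ t → z.pos ∉ S then 1 else 0) * U t z ∂(offer G v).toMeasure
      ≤ Φ t v := by
    intro t v
    by_cases hv : m ≤ t → v ∉ S
    · refine le_trans (lintegral_mono fun z => ?_) (hΦ t v hv)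
      split_ifs <;> simp [U]
    · rw [lintegral_offer G (hG v)]
      simp [hv]
  -- Supermartingale bookkeeping: elapsed expected time plus the expected remaining potential on the
  -- event of no visit never exceeds the initial potential.
  have hstep : ∀ N, ∑ t ∈ Finset.range N, ∫⁻ ω, avoids m S t (r t ω) ∂μ +
      ∫⁻ ω, avoids m S N (r N ω) * U N (ω N) ∂μ ≤ Φ 0 x := by
    intro N
    induction N with
    | zero =>
      simp only [Finset.range_zero, Finset.sum_empty, zero_add, r, avoids_zero]
      rw [hμ, lintegral_law_zero (markovStrategy δ) x
        fun z => (if m ≤ 0 → z.pos ∉ S then 1 else 0) * U 0 z]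
      exact hpos 0 x
    | succ N ih =>
      refine le_trans ?_ ih
      rw [Finset.sum_range_succ, add_assoc]
      gcongr
      have h1 : ∫⁻ ω, avoids m S (N + 1) (r (N + 1) ω) * U (N + 1) (ω (N + 1)) ∂μ ≤
          ∫⁻ ω, avoids m S N (r N ω) * Φ (N + 1) ((ω N).choose (δ N (ω N))) ∂μ := by
        simp only [r, avoids_succ, mul_assoc]
        rw [hμ, lintegral_law_succ (markovStrategy δ) x N fun h z => avoids m S N h *
          ((if m ≤ N + 1 → z.pos ∉ S then 1 else 0) * U (N + 1) z)]
        refine lintegral_mono fun ω => ?_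
        rw [lintegral_const_mul _ (measurable_of_countable _), step_markovStrategy]
        exact mul_le_mul_right (hpos _ _) _
      refine (add_le_add_right h1 _).trans (le_of_eq ?_)
      rw [← lintegral_add_left (hr N)]
      refine lintegral_congr fun ω => ?_
      simp only [U, mul_add, mul_one]
  calc ∫⁻ ω, firstVisit m S ω ∂μ ≤ ∫⁻ ω, ∑' t, avoids m S t (r t ω) ∂μ :=
        lintegral_mono fun ω => firstVisit_le_tsum m S ω
    _ = ∑' t, ∫⁻ ω, avoids m S t (r t ω) ∂μ :=
        lintegral_tsum fun t => (hr t).aemeasurable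
    _ ≤ Φ 0 x := ENNReal.tsum_le_of_sum_range_le fun N => le_self_add.trans (hstep N)

end ChoiceWalk

namespace ChoiceWalk
open Matrix

variable {V : Type*} [Fintype V] [DecidableEq V] {G : SimpleGraph V} [DecidableRel G.Adj]

/-! ### Spectral theory of the lazy walk -/

lemma lazyMatrix_apply (u v : V) :
    lazyMatrix G u v =
      (1 / 2) * ((if u = v then 1 else 0) + if G.Adj u v then 1 / (G.degree u : ℝ) else 0) := by
  simp [lazyMatrix, walkMatrix, Matrix.one_apply]

lemma lazyMatrix_mulVec (f : V → ℝ) (u : V) :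
    (lazyMatrix G *ᵥ f) u =
      (1 / 2) * (f u + (∑ v ∈ G.neighborFinset u, f v) / G.degree u) := by
  simp only [Matrix.mulVec, dotProduct, lazyMatrix_apply]
  rw [SimpleGraph.neighborFinset_eq_filter, Finset.sum_filter, Finset.sum_div, mul_add,
    Finset.mul_sum]
  have : f u = ∑ v, if u = v then f v else 0 := by simp
  rw [this, Finset.mul_sum, ← Finset.sum_add_distrib]
  refine Finset.sum_congr rfl fun v _ => ?_
  by_cases h : u = v <;> by_cases h' : G.Adj u v <;> simp [h, h']
  ring

/-- A diagonalization of the transition matrix of the lazy walk by functions which are orthonormal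
for the inner product weighted by the degrees. -/
lemma exists_lazyMatrix_diagonalization (hd : ∀ v, 0 < G.degree v) :
    ∃ (F : Matrix V V ℝ) (l : V → ℝ), lazyMatrix G * F = F * diagonal l ∧
      Fᵀ * diagonal (fun v => (G.degree v : ℝ)) * F = 1 ∧
      F * Fᵀ = diagonal (fun v => (G.degree v : ℝ)⁻¹) ∧
      (lazyMatrix G).charpoly.roots = Finset.univ.val.map l := by
  set s : V → ℝ := fun v => √(G.degree v) with hs
  have hdpos : ∀ v, (0 : ℝ) < G.degree v := fun v => by exact_mod_cast hd v
  have hspos : ∀ v, 0 < s v := fun v => Real.sqrt_pos.2 (hdpos v)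
  have hsq : ∀ v, s v * s v = G.degree v := fun v => Real.mul_self_sqrt (hdpos v).le
  have hinv : diagonal (fun v => (s v)⁻¹) * diagonal s = (1 : Matrix V V ℝ) := by
    rw [diagonal_mul_diagonal, ← diagonal_one]
    congr 1; ext v; exact inv_mul_cancel₀ (hspos v).ne'
  -- Reversibility: conjugation by the square roots of the degrees makes the transition matrix
  -- symmetric without changing its characteristic polynomial.
  set A : Matrix V V ℝ := diagonal s * lazyMatrix G * diagonal (fun v => (s v)⁻¹) with hA
  have hAH : A.IsHermitian := by
    ext u v
    rw [conjTranspose_apply, star_trivial, hA]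
    simp only [mul_diagonal, diagonal_mul, lazyMatrix_apply, G.adj_comm u v, eq_comm (a := v)]
    by_cases h : u = v
    · subst h; rfl
    · simp only [h, if_false, zero_add]
      split_ifs
      · rw [← hsq u, ← hsq v]
        have := (hspos u).ne'
        have := (hspos v).ne'
        field_simp
      · simp
  have hchar : A.charpoly = (lazyMatrix G).charpoly := by
    rw [hA, charpoly_mul_comm, ← mul_assoc, hinv, one_mul]
  set U : Matrix V V ℝ := hAH.eigenvectorUnitary.1 with hU
  have hU1 : Uᵀ * U = 1 := by
    have := Unitary.coe_star_mul_self hAH.eigenvectorUnitary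
    rwa [Matrix.star_eq_conjTranspose, conjTranspose_eq_transpose_of_trivial] at this
  have hU2 : U * Uᵀ = 1 := mul_eq_one_comm.1 hU1
  have hAU : A * U = U * diagonal hAH.eigenvalues := by
    ext u i
    have := congrFun (hAH.mulVec_eigenvectorBasis i) u
    rw [mul_diagonal, mul_comm]
    exact this
  refine ⟨diagonal (fun v => (s v)⁻¹) * U, hAH.eigenvalues, ?_, ?_, ?_, ?_⟩
  · rw [mul_assoc _ U, ← hAU, hA]
    simp only [← mul_assoc]
    rw [hinv, one_mul]
  · rw [transpose_mul, diagonal_transpose]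
    have : diagonal (fun v => (s v)⁻¹) * diagonal (fun v => (G.degree v : ℝ)) *
        diagonal (fun v => (s v)⁻¹) = (1 : Matrix V V ℝ) := by
      rw [diagonal_mul_diagonal, diagonal_mul_diagonal, ← diagonal_one]
      congr 1; ext v
      rw [← hsq v]
      have := (hspos v).ne'
      field_simp
    calc _ = Uᵀ * (diagonal (fun v => (s v)⁻¹) * diagonal (fun v => (G.degree v : ℝ)) *
        diagonal (fun v => (s v)⁻¹)) * U := by simp only [mul_assoc]
      _ = 1 := by rw [this, mul_one, hU1]
  · rw [transpose_mul, diagonal_transpose, mul_assoc, ← mul_assoc U, hU2, one_mul,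
      diagonal_mul_diagonal]
    congr 1; ext v
    rw [← mul_inv, hsq]
  · rw [← hchar, hAH.roots_charpoly_eq_eigenvalues]
    rfl

omit [DecidableEq V] in
lemma sum_sum_adj (g : V → ℝ) :
    ∑ x, ∑ y ∈ G.neighborFinset x, g y = ∑ y, G.degree y * g y := by
  simp only [SimpleGraph.neighborFinset_eq_filter, Finset.sum_filter]
  rw [Finset.sum_comm]
  refine Finset.sum_congr rfl fun y _ => ?_
  rw [← Finset.sum_filter, Finset.sum_const, nsmul_eq_mul]
  congr 2
  rw [← G.card_neighborFinset_eq_degree, SimpleGraph.neighborFinset_eq_filter]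
  congr 1
  ext x
  simp [G.adj_comm]

omit [DecidableEq V] in
/-- The Dirichlet form (`ε = -1`) and its signless variant (`ε = 1`) at an eigenfunction. -/
lemma sum_sum_adj_sq (f : V → ℝ) {μ ε : ℝ} (hε : ε ^ 2 = 1)
    (hf : ∀ x, ∑ y ∈ G.neighborFinset x, f y = μ * G.degree x * f x) :
    ∑ x, ∑ y ∈ G.neighborFinset x, (f x + ε * f y) ^ 2 =
      2 * (1 + ε * μ) * ∑ x, G.degree x * f x ^ 2 := by
  have h : ∀ x, ∑ y ∈ G.neighborFinset x, (f x + ε * f y) ^ 2 =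
      (1 + 2 * ε * μ) * (G.degree x * f x ^ 2) + ∑ y ∈ G.neighborFinset x, f y ^ 2 := by
    intro x
    have : ∀ y, (f x + ε * f y) ^ 2 = f x ^ 2 + 2 * ε * f x * f y + f y ^ 2 := fun y => by
      have : (f x + ε * f y) ^ 2 = f x ^ 2 + 2 * ε * f x * f y + ε ^ 2 * f y ^ 2 := by ring
      rw [this, hε, one_mul]
    simp only [this, Finset.sum_add_distrib, ← Finset.mul_sum, hf, Finset.sum_const,
      G.card_neighborFinset_eq_degree, nsmul_eq_mul]
    ring
  simp only [h, Finset.sum_add_distrib, ← Finset.mul_sum, sum_sum_adj]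
  ring

omit [Fintype V] [DecidableEq V] [DecidableRel G.Adj] in
lemma eq_of_forall_adj_eq (hG : G.Connected) {f : V → ℝ} (hf : ∀ x y, G.Adj x y → f x = f y)
    (x y : V) : f x = f y := by
  obtain ⟨p⟩ := hG.preconnected x y
  induction p with
  | nil => rfl
  | cons h _ ih => exact (hf _ _ h).trans ih

omit [DecidableEq V] in
lemma degree_pos [Nontrivial V] (hG : G.Connected) (v : V) : 0 < G.degree v :=
  hG.preconnected.degree_pos_of_nontrivial v

/-- The second eigenvalue of the lazy walk lies in `[0, 1)`, and it governs the convergence to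
the stationary distribution. -/
lemma lambdaTwo_spec [Nontrivial V] (hG : G.Connected) :
    0 ≤ lambdaTwo G ∧ lambdaTwo G < 1 ∧ ∀ (k : ℕ) (x y : V),
      G.degree y * (1 / ∑ v, (G.degree v : ℝ) - lambdaTwo G ^ k) ≤ (lazyMatrix G ^ k) x y := by
  have hd := degree_pos hG
  have hdpos : ∀ v, (0 : ℝ) < G.degree v := fun v => by exact_mod_cast hd v
  obtain ⟨F, l, hLF, hFDF, hFF, hroots⟩ := exists_lazyMatrix_diagonalization hd
  have horth : ∀ i j, ∑ x, G.degree x * (F x i * F x j) = if i = j then 1 else 0 := by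
    intro i j
    have := congrFun (congrFun hFDF i) j
    rw [Matrix.mul_apply, Matrix.one_apply] at this
    rw [← this]
    refine Finset.sum_congr rfl fun x _ => ?_
    rw [mul_diagonal, transpose_apply]; ring
  have hnorm : ∀ i, ∑ x, G.degree x * F x i ^ 2 = 1 := fun i => by
    simpa [pow_two] using horth i i
  have hrow : ∀ x y, ∑ i, F x i * F y i = if x = y then (G.degree x : ℝ)⁻¹ else 0 := by
    intro x y
    have := congrFun (congrFun hFF x) y
    rwa [Matrix.mul_apply, Matrix.diagonal_apply] at this
  -- A lazy eigenvalue `l` corresponds to the eigenvalue `2l - 1` of the simple walk.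
  have heig : ∀ i x, ∑ y ∈ G.neighborFinset x, F y i = (2 * l i - 1) * G.degree x * F x i := by
    intro i x
    have := congrFun (congrFun hLF x) i
    have h2 := lazyMatrix_mulVec (G := G) (fun y => F y i) x
    rw [mul_diagonal, Matrix.mul_apply] at this
    rw [Matrix.mulVec, dotProduct, this] at h2
    have h3 := (hdpos x).ne'
    field_simp at h2
    linarith
  have hl0 : ∀ i, 0 ≤ l i := by
    intro i
    have := sum_sum_adj_sq (fun y => F y i) (ε := 1) (by norm_num) (heig i)
    rw [hnorm] at this
    have h0 : 0 ≤ ∑ x, ∑ y ∈ G.neighborFinset x, (F x i + 1 * F y i) ^ 2 :=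
      Finset.sum_nonneg fun _ _ => Finset.sum_nonneg fun _ _ => sq_nonneg _
    linarith
  have hdir : ∀ i, ∑ x, ∑ y ∈ G.neighborFinset x, (F x i + -1 * F y i) ^ 2 = 4 * (1 - l i) := by
    intro i
    have := sum_sum_adj_sq (fun y => F y i) (ε := -1) (by norm_num) (heig i)
    rw [hnorm] at this
    rw [this]; ring
  have hl1 : ∀ i, l i ≤ 1 := by
    intro i
    have h0 : 0 ≤ ∑ x, ∑ y ∈ G.neighborFinset x, (F x i + -1 * F y i) ^ 2 :=
      Finset.sum_nonneg fun _ _ => Finset.sum_nonneg fun _ _ => sq_nonneg _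
    have := hdir i
    linarith
  have hconst : ∀ i, l i = 1 → ∀ x y, F x i = F y i := by
    intro i hi
    have := hdir i
    rw [hi, sub_self, mul_zero, Finset.sum_eq_zero_iff_of_nonneg fun _ _ =>
      Finset.sum_nonneg fun _ _ => sq_nonneg _] at this
    refine eq_of_forall_adj_eq hG fun x y hxy => ?_
    have h2 := this x (Finset.mem_univ _)
    rw [Finset.sum_eq_zero_iff_of_nonneg fun _ _ => sq_nonneg _] at h2
    have h3 := pow_eq_zero_iff (two_ne_zero) |>.1 (h2 y (by simpa using hxy))
    linarith
  have hsumd : 0 < ∑ v, (G.degree v : ℝ) :=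
    Finset.sum_pos (fun v _ => hdpos v) Finset.univ_nonempty
  have hcc : ∀ i j, l i = 1 → l j = 1 → ∀ x y,
      F x i * F y j * ∑ v, (G.degree v : ℝ) = if i = j then 1 else 0 := by
    intro i j hi hj x y
    rw [← horth i j, Finset.mul_sum]
    refine Finset.sum_congr rfl fun v _ => ?_
    rw [hconst i hi x v, hconst j hj y v]; ring
  -- Otherwise summing the eigenvalue equation shows every eigenfunction orthogonal to the
  -- constants, contradicting completeness of the eigenbasis.
  have hex : ∃ i, l i = 1 := by
    by_contra! hne
    have hg : ∀ i, ∑ x, G.degree x * F x i = 0 := by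
      intro i
      have h1 := sum_sum_adj (G := G) fun y => F y i
      simp only [heig, mul_assoc, ← Finset.mul_sum] at h1
      have h2 : (1 - l i) * ∑ x, G.degree x * F x i = 0 := by linarith
      exact (mul_eq_zero.1 h2).resolve_left fun h => hne i (by linarith)
    obtain ⟨x⟩ := hG.nonempty
    have h3 : ∑ y, G.degree y * ∑ i, F x i * F y i = 0 := by
      simp only [Finset.mul_sum]
      rw [Finset.sum_comm]
      refine Finset.sum_eq_zero fun i _ => ?_
      calc _ = F x i * ∑ y, G.degree y * F y i := by
            rw [Finset.mul_sum]; exact Finset.sum_congr rfl fun _ _ => by ring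
        _ = 0 := by rw [hg, mul_zero]
    simp only [hrow, mul_ite, mul_zero, Finset.sum_ite_eq, Finset.mem_univ, if_true] at h3
    rw [mul_inv_cancel₀ (hdpos x).ne'] at h3
    exact one_ne_zero h3
  obtain ⟨i₀, hi₀⟩ := hex
  -- Eigenfunctions for the eigenvalue `1` are constant, and two nonzero constants cannot be
  -- orthogonal.
  have huniq : ∀ i, i ≠ i₀ → l i < 1 := by
    intro i hi
    refine lt_of_le_of_ne (hl1 i) fun h => ?_
    obtain ⟨x⟩ := hG.nonempty
    have h1 := hcc i i₀ h hi₀ x x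
    have h2 := hcc i i h h x x
    have h3 := hcc i₀ i₀ hi₀ hi₀ x x
    rw [if_neg hi] at h1
    rw [if_pos rfl] at h2 h3
    have h4 : F x i * F x i₀ = 0 := (mul_eq_zero.1 h1).resolve_right hsumd.ne'
    rcases mul_eq_zero.1 h4 with h | h
    · simp [h] at h2
    · simp [h] at h3
  have hlam : (∃ i, i ≠ i₀ ∧ lambdaTwo G = l i) ∧ ∀ i, i ≠ i₀ → l i ≤ lambdaTwo G := by
    have hsplit : (Finset.univ.val.map l) = 1 ::ₘ ((Finset.univ.erase i₀).val.map l) := by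
      rw [← hi₀, ← Multiset.map_cons, ← Finset.insert_val_of_notMem (Finset.notMem_erase _ _),
        Finset.insert_erase (Finset.mem_univ _)]
    set R := (Finset.univ.erase i₀).val.map l with hR
    have hmemR : ∀ a, a ∈ R ↔ ∃ i, i ≠ i₀ ∧ l i = a := by
      intro a; rw [hR]; simp [-Finset.erase_val]
    have hsort : (Finset.univ.val.map l).sort (· ≥ ·) = 1 :: R.sort (· ≥ ·) := by
      rw [hsplit]
      refine Multiset.sort_cons _ _ _ fun b hb => ?_
      obtain ⟨i, -, rfl⟩ := (hmemR b).1 hb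
      exact hl1 i
    have hl2 : lambdaTwo G = (R.sort (· ≥ ·)).getD 0 0 := by
      rw [lambdaTwo, hroots, hsort, List.getD_cons_succ]
    -- A second vertex guarantees a second eigenvalue, so the default value of `getD` never occurs.
    obtain ⟨j, hj⟩ := exists_ne i₀
    have hmem : l j ∈ R.sort (· ≥ ·) := (Multiset.mem_sort _).2 ((hmemR _).2 ⟨j, hj, rfl⟩)
    have hpw := Multiset.pairwise_sort (r := (· ≥ ·)) R
    rcases hS : R.sort (· ≥ ·) with _ | ⟨a, S⟩
    · rw [hS] at hmem; simp at hmem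
    rw [hS] at hl2 hpw
    rw [List.getD_cons_zero] at hl2
    rw [hl2]
    refine ⟨?_, fun i hi => ?_⟩
    · have : a ∈ R.sort (· ≥ ·) := by rw [hS]; exact List.mem_cons_self
      obtain ⟨i, hi, h⟩ := (hmemR a).1 ((Multiset.mem_sort _).1 this)
      exact ⟨i, hi, h.symm⟩
    · have : l i ∈ R.sort (· ≥ ·) := (Multiset.mem_sort _).2 ((hmemR _).2 ⟨i, hi, rfl⟩)
      rw [hS] at this
      rcases List.mem_cons.1 this with h | h
      · exact h.le
      · exact (List.pairwise_cons.1 hpw).1 _ h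
  obtain ⟨⟨j, hj, hlj⟩, hle⟩ := hlam
  refine ⟨hlj ▸ hl0 j, hlj ▸ huniq j hj, fun k x y => ?_⟩
  have hpow : lazyMatrix G ^ k * F = F * diagonal (fun i => l i ^ k) := by
    induction k with
    | zero => simp
    | succ k ih =>
      rw [pow_succ, mul_assoc, hLF, ← mul_assoc, ih, mul_assoc, diagonal_mul_diagonal]
      simp only [pow_succ]
  have hentry : (lazyMatrix G ^ k) x y = G.degree y * ∑ i, l i ^ k * (F x i * F y i) := by
    have h0 : lazyMatrix G ^ k * diagonal (fun v => (G.degree v : ℝ)⁻¹) =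
        F * diagonal (fun i => l i ^ k) * Fᵀ := by rw [← hpow, mul_assoc, hFF]
    have h1 := congrFun (congrFun h0 x) y
    rw [mul_diagonal, Matrix.mul_apply] at h1
    simp only [mul_diagonal, transpose_apply] at h1
    have h2 := (hdpos y).ne'
    rw [← eq_div_iff_mul_eq (inv_ne_zero h2), div_inv_eq_mul] at h1
    rw [h1, mul_comm]
    congr 1
    exact Finset.sum_congr rfl fun _ _ => by ring
  have hxx : ∀ x, ∑ i, F x i ^ 2 ≤ 1 := by
    intro x
    have := hrow x x
    rw [if_pos rfl] at this
    simp only [pow_two, this]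
    exact inv_le_one_of_one_le₀ (by exact_mod_cast hd x)
  rw [hentry]
  refine mul_le_mul_of_nonneg_left ?_ (hdpos y).le
  rw [← Finset.add_sum_erase _ (fun i => l i ^ k * (F x i * F y i)) (Finset.mem_univ i₀), hi₀,
    one_pow, one_mul]
  have hmain : F x i₀ * F y i₀ = 1 / ∑ v, (G.degree v : ℝ) := by
    rw [eq_div_iff hsumd.ne', hcc i₀ i₀ hi₀ hi₀, if_pos rfl]
  have hlam0 : 0 ≤ lambdaTwo G := hlj ▸ hl0 j
  -- The constant eigenfunction contributes `1 / ∑ d`; the others are bounded by `|ab| ≤ (a² +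
  -- b²)/2`, and their total weight is at most `1` by `hxx`.
  have hrest : ∀ i ∈ Finset.univ.erase i₀,
      -(lambdaTwo G ^ k * ((F x i ^ 2 + F y i ^ 2) / 2)) ≤ l i ^ k * (F x i * F y i) := by
    intro i hi
    have h1 : l i ^ k ≤ lambdaTwo G ^ k :=
      pow_le_pow_left₀ (hl0 i) (hle i (Finset.ne_of_mem_erase hi)) k
    have h2 : -((F x i ^ 2 + F y i ^ 2) / 2) ≤ F x i * F y i := by
      nlinarith [sq_nonneg (F x i + F y i)]
    have h3 : 0 ≤ (F x i ^ 2 + F y i ^ 2) / 2 := by positivity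
    have h4 := mul_le_mul_of_nonneg_left h2 (pow_nonneg (hl0 i) k)
    have h5 := mul_le_mul_of_nonneg_right h1 h3
    linarith
  have hsum := Finset.sum_le_sum hrest
  have htot : ∑ i ∈ Finset.univ.erase i₀, ((F x i ^ 2 + F y i ^ 2) / 2) ≤ 1 := by
    calc _ ≤ ∑ i, ((F x i ^ 2 + F y i ^ 2) / 2) :=
          Finset.sum_le_sum_of_subset_of_nonneg (Finset.erase_subset _ _)
            fun _ _ _ => by positivity
      _ = (∑ i, F x i ^ 2 + ∑ i, F y i ^ 2) / 2 := by
          rw [← Finset.sum_add_distrib, Finset.sum_div]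
      _ ≤ 1 := by linarith [hxx x, hxx y]
  rw [Finset.sum_neg_distrib, ← Finset.mul_sum] at hsum
  have := mul_le_mul_of_nonneg_left htot (pow_nonneg hlam0 k)
  rw [hmain]
  linarith

end ChoiceWalk

namespace ChoiceWalk
open MeasureTheory ProbabilityTheory
open scoped ENNReal

/-! ### Hitting probabilities and the block strategy -/

section Strategies

variable {V : Type*} [Fintype V] [DecidableEq V] (G : SimpleGraph V) [DecidableRel G.Adj]

/-- The probability that the simple random walk visits `S` within the first `k` steps. -/
noncomputable def hitProb (S : Finset V) : ℕ → V → ℝ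
  | 0, x => if x ∈ S then 1 else 0
  | k + 1, x => if x ∈ S then 1 else (∑ y ∈ G.neighborFinset x, hitProb S k y) / G.degree x

variable {G}

lemma hitProb_of_mem {S : Finset V} {x : V} (hx : x ∈ S) (k : ℕ) : hitProb G S k x = 1 := by
  cases k <;> simp [hitProb, hx]

lemma hitProb_nonneg (S : Finset V) (k : ℕ) (x : V) : 0 ≤ hitProb G S k x := by
  induction k generalizing x with
  | zero => unfold hitProb; split_ifs <;> norm_num
  | succ k ih =>
    unfold hitProb; split_ifs
    · norm_num
    · exact div_nonneg (Finset.sum_nonneg fun y _ => ih y) (by positivity)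

lemma hitProb_le_one (S : Finset V) (k : ℕ) (x : V) : hitProb G S k x ≤ 1 := by
  induction k generalizing x with
  | zero => unfold hitProb; split_ifs <;> norm_num
  | succ k ih =>
    unfold hitProb; split_ifs
    · norm_num
    · refine div_le_one_of_le₀ ?_ (by positivity)
      refine (Finset.sum_le_card_nsmul _ _ 1 fun y _ => ih y).trans ?_
      simp

lemma hitProb_le_succ (S : Finset V) (k : ℕ) (x : V) :
    hitProb G S k x ≤ hitProb G S (k + 1) x := by
  induction k generalizing x with
  | zero =>
    by_cases hx : x ∈ S
    · simp [hitProb_of_mem hx]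
    · exact (le_of_eq (by simp [hitProb, hx])).trans (hitProb_nonneg S 1 x)
  | succ k ih =>
    by_cases hx : x ∈ S
    · simp [hitProb_of_mem hx]
    · rw [hitProb, hitProb, if_neg hx, if_neg hx]
      gcongr with y
      exact ih y

open Matrix in
-- Being in `S` at time `k` implies a visit by time `k`, and holding steps only delay visits: a lazy
-- step averages `hitProb` at `k` and a bound by `hitProb` at `k + 1`, and `hitProb` increases in
-- `k`.
lemma lazyMatrix_pow_sum_le_hitProb (S : Finset V) (k : ℕ) (x : V) :
    ∑ y ∈ S, (lazyMatrix G ^ k) x y ≤ hitProb G S k x := by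
  have hsum : ∀ k x, ∑ y ∈ S, (lazyMatrix G ^ k) x y =
      (lazyMatrix G ^ k *ᵥ fun y => if y ∈ S then 1 else 0) x := by
    intro k x
    simp [Matrix.mulVec, dotProduct]
  rw [hsum]
  induction k generalizing x with
  | zero => simp [hitProb]
  | succ k ih =>
    rw [pow_succ', ← Matrix.mulVec_mulVec, lazyMatrix_mulVec]
    have h1 : (∑ v ∈ G.neighborFinset x,
        (lazyMatrix G ^ k *ᵥ fun y => if y ∈ S then 1 else 0) v) / G.degree x ≤
        (∑ v ∈ G.neighborFinset x, hitProb G S k v) / G.degree x := by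
      gcongr with v
      exact ih v
    have h2 : (∑ v ∈ G.neighborFinset x, hitProb G S k v) / G.degree x ≤
        hitProb G S (k + 1) x := by
      rw [hitProb]
      split_ifs
      · refine div_le_one_of_le₀ ?_ (by positivity)
        refine (Finset.sum_le_card_nsmul _ _ 1 fun y _ => hitProb_le_one S k y).trans ?_
        simp
      · exact le_rfl
    have h3 := ih x
    have h4 := hitProb_le_succ (G := G) S k x
    linarith

omit [DecidableEq V] in
lemma lintegral_offer_le {v : V} (hv : (G.neighborFinset v).Nonempty) {F : State V → ℝ≥0∞}
    {R : V → V → ℝ} (hR : ∀ a b, 0 ≤ R a b) (hF : ∀ a b, F ⟨v, a, b⟩ ≤ ENNReal.ofReal (R a b)) :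
    ∫⁻ z, F z ∂(offer G v).toMeasure ≤ ENNReal.ofReal
      ((∑ a ∈ G.neighborFinset v, ∑ b ∈ G.neighborFinset v, R a b) / (G.degree v : ℝ) ^ 2) := by
  have hd : (0 : ℝ) < G.degree v := by
    rw [← G.card_neighborFinset_eq_degree]; exact_mod_cast hv.card_pos
  have hinv : ((G.degree v : ℝ≥0∞))⁻¹ = ENNReal.ofReal ((G.degree v : ℝ)⁻¹) := by
    rw [ENNReal.ofReal_inv_of_pos hd, ENNReal.ofReal_natCast]
  rw [lintegral_offer G hv]
  calc _ ≤ (G.degree v : ℝ≥0∞)⁻¹ * ∑ a ∈ G.neighborFinset v,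
        ((G.degree v : ℝ≥0∞)⁻¹ * ∑ b ∈ G.neighborFinset v, ENNReal.ofReal (R a b)) := by
        gcongr with a _ b
        exact hF a b
    _ = _ := by
      simp only [hinv, ← ENNReal.ofReal_sum_of_nonneg fun b _ => hR _ b]
      simp only [← ENNReal.ofReal_mul (inv_nonneg.2 hd.le)]
      rw [← ENNReal.ofReal_sum_of_nonneg fun a _ => mul_nonneg (inv_nonneg.2 hd.le)
        (Finset.sum_nonneg fun b _ => hR a b), ← ENNReal.ofReal_mul (inv_nonneg.2 hd.le),
        ← Finset.mul_sum]
      congr 1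
      field_simp

/-- The strategy which splits the time into blocks of length `T` and in each block maximizes the
probability that the simple random walk visits `S` in the rest of the block. -/
lemma exists_lyapunov (hG : ∀ v, (G.neighborFinset v).Nonempty) (S : Finset V) {T : ℕ}
    (hT : 1 ≤ T) {A : ℝ} (hA : ∀ x, T ≤ A * boost G.maxDegree (hitProb G S T x)) (hA0 : 0 ≤ A) :
    ∃ (δ : ℕ → State V → Bool) (Φ : ℕ → V → ℝ≥0∞),
      (∀ t, ∀ v ∉ S, ∫⁻ z, (1 + Φ (t + 1) (z.choose (δ t z))) ∂(offer G v).toMeasure ≤ Φ t v) ∧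
      ∀ x, Φ 0 x ≤ ENNReal.ofReal A := by
  classical
  set D := G.maxDegree with hDdef
  let g : ℕ → V → ℝ := fun r x => boost D (hitProb G S r x)
  have hdeg : ∀ v, 1 ≤ G.degree v := fun v => by
    rw [← G.card_neighborFinset_eq_degree]; exact (hG v).card_pos
  -- Number of steps left in the block after the step taken at time `t`; before that step there are
  -- `rem t + 1`.
  let rem : ℕ → ℕ := fun t => T - 1 - t % T
  -- Bound for the remaining time: finish the block, and on failure, of probability at most `1 - g r
  -- x`, pay `A` for a fresh start. The hypothesis on `A` says exactly that `κ T x ≤ A`.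
  let κ : ℕ → V → ℝ := fun r x => r + (1 - g r x) * A
  let δ : ℕ → State V → Bool := fun t z =>
    decide (hitProb G S (rem t) z.snd ≤ hitProb G S (rem t) z.fst)
  let Φ : ℕ → V → ℝ≥0∞ := fun t x => if x ∈ S then 0 else ENNReal.ofReal (κ (rem t + 1) x)
  have hκT : ∀ x, κ T x ≤ A := fun x => by
    have := hA x
    simp only [κ, g]; linarith
  refine ⟨δ, Φ, fun t v hv => ?_, fun x => ?_⟩
  swap
  · simp only [Φ]
    split_ifs
    · exact zero_le
    · refine ENNReal.ofReal_le_ofReal ?_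
      have : rem 0 + 1 = T := by simp only [rem, Nat.zero_mod]; omega
      rw [this]; exact hκT x
  have hD : 1 ≤ D := (hdeg v).trans (G.degree_le_maxDegree v)
  have hg1 : ∀ r x, g r x ≤ 1 := fun r x =>
    boost_le_one hD (hitProb_nonneg S r x) (hitProb_le_one S r x)
  have hκ0 : ∀ r x, 0 ≤ κ r x := fun r x =>
    add_nonneg (Nat.cast_nonneg r) (mul_nonneg (sub_nonneg.2 (hg1 r x)) hA0)
  have hnext : ∀ y, Φ (t + 1) y ≤ ENNReal.ofReal (κ (rem t) y) := by
    intro y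
    simp only [Φ]
    split_ifs with hy
    · exact zero_le
    · refine ENNReal.ofReal_le_ofReal ?_
      have hlt := Nat.mod_lt t hT
      rcases Nat.lt_or_ge (t % T + 1) T with h | h
      · have h1 : (t + 1) % T = t % T + 1 := by
          rw [← Nat.mod_add_mod, Nat.mod_eq_of_lt h]
        have : rem (t + 1) + 1 = rem t := by simp only [rem, h1]; omega
        rw [this]
      · have h0 : t % T + 1 = T := by omega
        have h1 : (t + 1) % T = 0 := by rw [← Nat.mod_add_mod, h0, Nat.mod_self]
        have h2 : rem (t + 1) + 1 = T := by simp only [rem, h1]; omega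
        have h3 : rem t = 0 := by simp only [rem]; omega
        rw [h2, h3]
        refine (hκT y).trans (le_of_eq ?_)
        -- At the end of a failed block the convention `boost D 0 = 0` gives `κ 0 y = A`, also when
        -- the exponent is `0`.
        simp [κ, g, hitProb, hy, boost_zero]
  have hchoose : ∀ a b, g (rem t) ((⟨v, a, b⟩ : State V).choose (δ t ⟨v, a, b⟩)) =
      max (g (rem t) a) (g (rem t) b) := by
    intro a b
    by_cases h : hitProb G S (rem t) b ≤ hitProb G S (rem t) a
    · have : g (rem t) b ≤ g (rem t) a := boost_mono hD (hitProb_nonneg S _ b) h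
      simp [State.choose, δ, h, this]
    · have : g (rem t) a ≤ g (rem t) b :=
        boost_mono hD (hitProb_nonneg S _ a) (not_le.1 h).le
      simp [State.choose, δ, h, this]
  have hint := lintegral_offer_le (G := G) (hG v)
    (F := fun z => 1 + Φ (t + 1) (z.choose (δ t z)))
    (R := fun a b => 1 + κ (rem t) ((⟨v, a, b⟩ : State V).choose (δ t ⟨v, a, b⟩)))
    (fun a b => add_nonneg zero_le_one (hκ0 _ _)) (fun a b => by
      rw [ENNReal.ofReal_add zero_le_one (hκ0 _ _), ENNReal.ofReal_one]
      exact add_le_add_right (hnext _) _)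
  refine hint.trans ?_
  simp only [Φ, if_neg hv]
  refine ENNReal.ofReal_le_ofReal ?_
  have hd : (0 : ℝ) < G.degree v := by exact_mod_cast hdeg v
  have hb := boost_average_le (D := D) (G.neighborFinset v) (hG v)
    (by rw [G.card_neighborFinset_eq_degree]; exact G.degree_le_maxDegree v)
    (hitProb G S (rem t)) (hitProb_nonneg S _)
  rw [G.card_neighborFinset_eq_degree] at hb
  have hgv : g (rem t + 1) v =
      boost D ((∑ y ∈ G.neighborFinset v, hitProb G S (rem t) y) / G.degree v) := by
    simp only [g, hitProb, if_neg hv]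
  rw [← hgv] at hb
  have hsum : ∑ a ∈ G.neighborFinset v, ∑ b ∈ G.neighborFinset v,
      (1 + κ (rem t) ((⟨v, a, b⟩ : State V).choose (δ t ⟨v, a, b⟩))) =
      (G.degree v : ℝ) ^ 2 * (1 + rem t + A) - A * ∑ a ∈ G.neighborFinset v,
        ∑ b ∈ G.neighborFinset v, max (g (rem t) a) (g (rem t) b) := by
    have : ∀ a b, 1 + κ (rem t) ((⟨v, a, b⟩ : State V).choose (δ t ⟨v, a, b⟩)) =
        (1 + rem t + A) - A * max (g (rem t) a) (g (rem t) b) := by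
      intro a b
      simp only [κ, hchoose]; ring
    simp only [this, Finset.sum_sub_distrib, ← Finset.mul_sum, Finset.sum_const,
      G.card_neighborFinset_eq_degree, nsmul_eq_mul]
    ring
  rw [hsum, sub_div, mul_div_cancel_left₀ _ (by positivity), mul_div_assoc]
  have := mul_le_mul_of_nonneg_left hb hA0
  simp only [κ, Nat.cast_add, Nat.cast_one]
  linarith

lemma hit_le (hG : ∀ v, (G.neighborFinset v).Nonempty) (S : Finset V) {T : ℕ}
    (hT : 1 ≤ T) {A : ℝ} (hA : ∀ x, T ≤ A * boost G.maxDegree (hitProb G S T x)) (hA0 : 0 ≤ A)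
    (x : V) : hit G x S ≤ ENNReal.ofReal A := by
  obtain ⟨δ, Φ, hΦ, h0⟩ := exists_lyapunov hG S hT hA hA0
  exact (iInf_le _ (markovStrategy δ)).trans <|
    (lintegral_firstVisit_le hG δ 0 S Φ (fun t v hv => hΦ t v (hv (Nat.zero_le t))) x).trans (h0 x)

lemma ret_le (hG : ∀ v, (G.neighborFinset v).Nonempty) (S : Finset V) {T : ℕ}
    (hT : 1 ≤ T) {A : ℝ} (hA : ∀ x, T ≤ A * boost G.maxDegree (hitProb G S T x)) (hA0 : 0 ≤ A)
    (x : V) : ret G x S ≤ ENNReal.ofReal (1 + A) := by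
  obtain ⟨δ, Φ, hΦ, h0⟩ := exists_lyapunov hG S hT hA hA0
  -- The first step is arbitrary and costs `1`; from time `1` on, the hitting strategy is used with
  -- its clock shifted.
  let Ψ : ℕ → V → ℝ≥0∞ := fun t => t.casesOn (fun _ => 1 + ENNReal.ofReal A) Φ
  refine (iInf_le _ (markovStrategy fun t => δ (t - 1))).trans <|
    (lintegral_firstVisit_le hG _ 1 S Ψ (fun t v hv => ?_) x).trans (le_of_eq ?_)
  · cases t with
    | zero =>
      refine (lintegral_mono (g := fun _ => 1 + ENNReal.ofReal A)
        fun z => add_le_add_right (h0 _) _).trans ?_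
      simp [Ψ]
    | succ t => exact hΦ t v (hv (by omega))
  · change 1 + ENNReal.ofReal A = _
    rw [ENNReal.ofReal_add zero_le_one hA0, ENNReal.ofReal_one]

end Strategies

/-! ### Choice of the block length and the constant -/

section Main

variable {V : Type*} [Fintype V] [DecidableEq V] [Nontrivial V] {G : SimpleGraph V}
  [DecidableRel G.Adj]

omit [DecidableEq V] in
lemma sum_degree_pos (hG : G.Connected) : 0 < ∑ v, (G.degree v : ℝ) :=
  Finset.sum_pos (fun v _ => by exact_mod_cast degree_pos hG v) Finset.univ_nonempty

omit [DecidableEq V] in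
lemma statProb_pos (hG : G.Connected) {S : Finset V} (hS : S.Nonempty) : 0 < statProb G S :=
  Finset.sum_pos (fun v _ => div_pos (by exact_mod_cast degree_pos hG v) (sum_degree_pos hG)) hS

omit [DecidableEq V] in
lemma statProb_le_one (hG : G.Connected) (S : Finset V) : statProb G S ≤ 1 := by
  rw [statProb, ← Finset.sum_div, div_le_one (sum_degree_pos hG)]
  exact Finset.sum_le_sum_of_subset_of_nonneg (Finset.subset_univ S) fun _ _ _ => by positivity

lemma one_le_relaxTime (hG : G.Connected) : 1 ≤ relaxTime G := by
  obtain ⟨h0, h1, -⟩ := lambdaTwo_spec hG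
  rw [relaxTime, le_div_iff₀ (by linarith)]
  linarith

/-- Combines `λ ≤ exp (-(1 - λ))` with `∑ d ≤ n²`; the `log 2` makes the error at most half of the
stationary main term. -/
lemma lambdaTwo_pow_le (hG : G.Connected) {T : ℕ}
    (hT : relaxTime G * (2 * Real.log (Fintype.card V) + Real.log 2) ≤ T) :
    lambdaTwo G ^ T ≤ 1 / (2 * ∑ v, (G.degree v : ℝ)) := by
  obtain ⟨h0, h1, -⟩ := lambdaTwo_spec hG
  have hn : (0 : ℝ) < Fintype.card V := by exact_mod_cast Fintype.card_pos
  have hgap : 0 < 1 - lambdaTwo G := by linarith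
  have hlog : Real.log (2 * (Fintype.card V : ℝ) ^ 2) =
      2 * Real.log (Fintype.card V) + Real.log 2 := by
    rw [Real.log_mul two_ne_zero (by positivity), Real.log_pow]; push_cast; ring
  rw [← hlog, relaxTime, one_div_mul_eq_div, div_le_iff₀ hgap] at hT
  have hsum : ∑ v, (G.degree v : ℝ) ≤ (Fintype.card V : ℝ) ^ 2 := by
    refine (Finset.sum_le_card_nsmul _ _ (Fintype.card V : ℝ) fun v _ => ?_).trans ?_
    · exact_mod_cast (G.degree_lt_card_verts v).le
    · simp [pow_two]
  calc lambdaTwo G ^ T ≤ Real.exp (-(1 - lambdaTwo G)) ^ T := by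
        gcongr
        have := Real.add_one_le_exp (-(1 - lambdaTwo G))
        linarith
    _ = Real.exp (-(T * (1 - lambdaTwo G))) := by rw [← Real.exp_nat_mul]; congr 1; ring
    _ ≤ Real.exp (-Real.log (2 * (Fintype.card V : ℝ) ^ 2)) := by gcongr
    _ = 1 / (2 * (Fintype.card V : ℝ) ^ 2) := by
        rw [Real.exp_neg, Real.exp_log (by positivity), one_div]
    _ ≤ 1 / (2 * ∑ v, (G.degree v : ℝ)) := by
        have := sum_degree_pos hG
        gcongr

lemma half_statProb_le_hitProb (hG : G.Connected) (S : Finset V) {T : ℕ}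
    (hT : relaxTime G * (2 * Real.log (Fintype.card V) + Real.log 2) ≤ T) (x : V) :
    statProb G S / 2 ≤ hitProb G S T x := by
  refine le_trans ?_ (lazyMatrix_pow_sum_le_hitProb S T x)
  rw [statProb, Finset.sum_div]
  refine Finset.sum_le_sum fun y _ => le_trans ?_ ((lambdaTwo_spec hG).2.2 T x y)
  have h1 := lambdaTwo_pow_le hG hT
  have h2 : (G.degree y : ℝ) / (∑ v, (G.degree v : ℝ)) / 2 =
      G.degree y * (1 / (∑ v, (G.degree v : ℝ)) - 1 / (2 * ∑ v, (G.degree v : ℝ))) := by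
    have := (sum_degree_pos hG).ne'
    field_simp
    ring
  rw [h2]
  gcongr

lemma exists_block (hG : G.Connected) {S : Finset V} (hS : S.Nonempty) :
    ∃ (T : ℕ) (A : ℝ), 1 ≤ T ∧ 0 ≤ A ∧ (∀ x, T ≤ A * boost G.maxDegree (hitProb G S T x)) ∧
      1 + A ≤ 12 * statProb G S ^ (-gammaExp G.maxDegree) * relaxTime G *
        Real.log (Fintype.card V) := by
  obtain ⟨x₀⟩ := hG.nonempty
  have hD : 1 ≤ G.maxDegree :=
    (Nat.succ_le_of_lt (degree_pos hG x₀)).trans (G.degree_le_maxDegree x₀)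
  have ht := one_le_relaxTime hG
  have hπ := statProb_pos hG hS
  have hπ1 := statProb_le_one hG S
  have hlog2 : 1 / 2 < Real.log 2 := by linarith [Real.log_two_gt_d9]
  have hl : Real.log 2 ≤ Real.log (Fintype.card V) :=
    Real.log_le_log (by norm_num) (by exact_mod_cast Fintype.one_lt_card)
  set l := Real.log (Fintype.card V)
  set t := relaxTime G
  set γ := gammaExp G.maxDegree with hγ
  have hγ0 : 0 ≤ γ := gammaExp_nonneg hD
  have hγ1 : γ ≤ 1 := gammaExp_le_one _
  set T := ⌈t * (2 * l + Real.log 2)⌉₊ with hTdef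
  have hT : t * (2 * l + Real.log 2) ≤ T := Nat.le_ceil _
  have hTpos : 0 < t * (2 * l + Real.log 2) := by positivity
  have hTlt : (T : ℝ) < t * (2 * l + Real.log 2) + 1 := Nat.ceil_lt_add_one hTpos.le
  have hq : 0 < (statProb G S / 2) ^ γ := by positivity
  refine ⟨T, T / (statProb G S / 2) ^ γ, Nat.ceil_pos.2 hTpos, by positivity, fun x => ?_, ?_⟩
  · have := boost_mono hD (by positivity) (half_statProb_le_hitProb hG S hT x)
    rw [boost_of_pos (by positivity)] at this
    rw [div_mul_eq_mul_div, le_div_iff₀ hq]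
    gcongr
  · set Q := statProb G S ^ (-γ) with hQdef
    have hQ : 1 ≤ Q := Real.one_le_rpow_of_pos_of_le_one_of_nonpos hπ hπ1 (by linarith)
    have h2 : (2 : ℝ) ^ γ ≤ 2 := by
      simpa using Real.rpow_le_rpow_of_exponent_le (one_le_two : (1 : ℝ) ≤ 2) hγ1
    have hA : T / (statProb G S / 2) ^ γ = T * 2 ^ γ * Q := by
      rw [Real.div_rpow hπ.le zero_le_two, hQdef, Real.rpow_neg hπ.le]
      field_simp
    rw [hA]
    have h3 : T * 2 ^ γ * Q ≤ T * 2 * Q := by gcongr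
    have htl : t * Real.log 2 ≤ t * l := by gcongr
    have htl2 : 1 / 2 ≤ t * l := by nlinarith
    -- Rounding gives `1 + 2T ≤ 3 + 4tl + 2t log 2 ≤ 3 + 6tl`, and `3 ≤ 6tl`. The extra `1` pays for
    -- the first step of a return.
    have h4 : 1 + T * 2 ≤ 12 * (t * l) := by linarith
    calc 1 + T * 2 ^ γ * Q ≤ Q * (1 + T * 2) := by linarith
      _ ≤ Q * (12 * (t * l)) := by gcongr
      _ = 12 * Q * t * l := by ring

end Main

end ChoiceWalk

theorem theorem5p2 {V : Type*} [Fintype V] [DecidableEq V] [Nontrivial V]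
    (G : SimpleGraph V) [DecidableRel G.Adj] (hG : G.Connected) :
    (∀ (x : V) (S : Finset V), S.Nonempty →
      ChoiceWalk.hit G x S ≤ ENNReal.ofReal
          (12 * ChoiceWalk.statProb G S ^ (-ChoiceWalk.gammaExp G.maxDegree)
            * ChoiceWalk.relaxTime G * Real.log (Fintype.card V)) ∧
      ChoiceWalk.ret G x S ≤ ENNReal.ofReal
          (12 * ChoiceWalk.statProb G S ^ (-ChoiceWalk.gammaExp G.maxDegree)
            * ChoiceWalk.relaxTime G * Real.log (Fintype.card V))) ∧
    ChoiceWalk.maxHit G ≤ ENNReal.ofReal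
      (12 * ((Fintype.card V : ℝ) * ChoiceWalk.avgDegree G / (G.minDegree : ℝ))
          ^ ChoiceWalk.gammaExp G.maxDegree
        * ChoiceWalk.relaxTime G * Real.log (Fintype.card V)) := by
  have hne : ∀ v, (G.neighborFinset v).Nonempty := fun v => by
    rw [← Finset.card_pos, G.card_neighborFinset_eq_degree]
    exact ChoiceWalk.degree_pos hG v
  have hbound : ∀ (x : V) (S : Finset V), S.Nonempty →
      ChoiceWalk.hit G x S ≤ ENNReal.ofReal
          (12 * ChoiceWalk.statProb G S ^ (-ChoiceWalk.gammaExp G.maxDegree)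
            * ChoiceWalk.relaxTime G * Real.log (Fintype.card V)) ∧
      ChoiceWalk.ret G x S ≤ ENNReal.ofReal
          (12 * ChoiceWalk.statProb G S ^ (-ChoiceWalk.gammaExp G.maxDegree)
            * ChoiceWalk.relaxTime G * Real.log (Fintype.card V)) := by
    intro x S hS
    obtain ⟨T, A, hT, hA0, hA, hle⟩ := ChoiceWalk.exists_block hG hS
    exact ⟨(ChoiceWalk.hit_le hne S hT hA hA0 x).trans (ENNReal.ofReal_le_ofReal (by linarith)),
      (ChoiceWalk.ret_le hne S hT hA hA0 x).trans (ENNReal.ofReal_le_ofReal hle)⟩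
  refine ⟨hbound, iSup₂_le fun x y => ?_⟩
  refine (hbound x {y} (Finset.singleton_nonempty y)).1.trans (ENNReal.ofReal_le_ofReal ?_)
  have hπ := ChoiceWalk.statProb_pos hG (Finset.singleton_nonempty y)
  have ht := ChoiceWalk.one_le_relaxTime hG
  have hl : 0 ≤ Real.log (Fintype.card V) := Real.log_natCast_nonneg _
  have hγ : 0 ≤ ChoiceWalk.gammaExp G.maxDegree := ChoiceWalk.gammaExp_nonneg
    ((Nat.succ_le_of_lt (ChoiceWalk.degree_pos hG x)).trans (G.degree_le_maxDegree x))
  have hsum := ChoiceWalk.sum_degree_pos hG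
  have hn : (0 : ℝ) < Fintype.card V := by exact_mod_cast Fintype.card_pos
  have hmin : (0 : ℝ) < G.minDegree := by
    obtain ⟨v, hv⟩ := G.exists_minimal_degree_vertex
    rw [hv]; exact_mod_cast ChoiceWalk.degree_pos hG v
  gcongr
  -- For a singleton, `1/π(y) = n * d_avg / d(y)`, which is largest at minimum degree.
  rw [Real.rpow_neg hπ.le, ← Real.inv_rpow hπ.le]
  refine Real.rpow_le_rpow (inv_nonneg.2 hπ.le) ?_ hγ
  rw [ChoiceWalk.statProb, Finset.sum_singleton, inv_div, ChoiceWalk.avgDegree,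
    mul_div_cancel₀ _ hn.ne']
  gcongr
  exact G.minDegree_le_degree y
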